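/- Let $p$ be a prime, $n\ge 1$, and equip $\mathbb{Q}_p^n$ with the norm $\|x\|_p=\max_i|x_i|_p$ and the Haar measure giving $\mathbb{Z}_p^n=\{\|x\|_p\le 1\}$ volume $1$. Put $\xi\cdot x=\sum_i\xi_ix_i$ and $\chi_p(y)=e^{2\pi i\{y\}_p}$, where $\{y\}_p$ is the $p$-adic fractional part. Let $\beta>0$ and let $A_\beta(\xi)=A_\beta(\|\xi\|_p)$ be a radial function on $\mathbb{Q}_p^n$ with $C_0\|\xi\|_p^\beta\le A_\beta(\xi)\le C_1\|\xi\|_p^\beta$ for all $\xi$, for some constants $C_0,C_1>0$. Let $\boldsymbol{A}_\beta\varphi=\mathcal{F}^{-1}(A_\beta\,\mathcal{F}\varphi)$, where $(\mathcal{F}\varphi)(\xi)=\int\chi_p(\xi\cdot x)\varphi(x)\,d^nx$ and $(\mathcal{F}^{-1}\psi)(x)=\int\chi_p(-\xi\cdot x)\psi(\xi)\,d^n\xi$. For $\gamma\in\mathbb{Z}$, $b\in(\mathbb{Q}_p/\mathbb{Z}_p)^n$ (each $b$ being given by an arbitrarily chosen representative in $\mathbb{Q}_p^n$) and $k\in\{0,\dots,p-1\}^n\setminus\{0\}$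 let $$\omega_{\gamma bk}(x)=p^{-n\gamma/2}\,\chi_p\big(p^{-1}k\cdot(p^\gamma x-b)\big)\,1_{\mathbb{Z}_p^n}(p^\gamma x-b),\qquad \lambda_{\gamma bk}=A_\beta(p^{1-\gamma}).$$ Let $(\omega_m)_{m\ge 1}$ be an enumeration, without repetition, of all the $\omega_{\gamma bk}$ whose support is contained in $\mathbb{Z}_p^n$, and $(\lambda_m)_{m\ge1}$ the corresponding numbers $\lambda_{\gamma bk}$ (for instance, but not necessarily, an enumeration with $\lambda_1\le\lambda_2\le\cdots$). Then: (1) each $\omega_m$ is a locally constant function with compact support in $\mathbb{Z}_p^n$ and integral $0$, and $\boldsymbol{A}_\beta\omega_m=\lambda_m\omega_m$; (2) for all $t>0$ and $x\in\mathbb{Q}_p^n$ the integral $$K(x,t)=\int_{\mathbb{Q}_p^n\setminus\mathbb{Z}_p^n}\chi_p(-x\cdot\xi)\,e^{-tA_\beta(\xi)}\,d^n\xi$$ converges absolutely; (3) for $x,y\in\mathbb{Z}_p^n$ and $t>0$, $$K(x-y,t)=\sum_{m=1}^\infty e^{-\lambda_mt}\,\omega_m(x)\,\overline{\omega_m(y)},$$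 and for every $\varepsilon>0$ the series converges uniformly on $\mathbb{Z}_p^n\times\mathbb{Z}_p^n\times[\varepsilon,\infty)$. -/

import Mathlib

open Filter MeasureTheory
open scoped Matrix

namespace PadicHeat

noncomputable section

/-! ### Fractional part and the standard additive character of `ℚ_[p]` -/

/-- Multiplying `x` by `p ^ m` with `m = max (-ord x) 0` gives a `p`-adic integer. -/
theorem norm_pow_mul_le_one (p : ℕ) [Fact p.Prime] (x : ℚ_[p]) :
    ‖(p : ℚ_[p]) ^ (-x.valuation).toNat * x‖ ≤ 1 := by
  rcases eq_or_ne x 0 with rfl | hx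
  · simp
  · have hp : (1 : ℝ) < p := by exact_mod_cast (Fact.out : p.Prime).one_lt
    have hp0 : (p : ℝ) ≠ 0 := by positivity
    rw [norm_mul, Padic.norm_p_pow, Padic.norm_eq_zpow_neg_valuation hx, ← zpow_add₀ hp0]
    apply zpow_le_one_of_nonpos₀ hp.le
    omega

/-- The fractional part `{x}_p`: if `x = p ^ (-m) * (x₀ + x₁ p + x₂ p ^ 2 + ⋯)` with
`m = max (-ord x) 0` and digits `xⱼ`, this is `p ^ (-m) * (x₀ + ⋯ + x_{m-1} p ^ (m-1))`
(and `0` if `m = 0`). -/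
def fracPart (p : ℕ) [Fact p.Prime] (x : ℚ_[p]) : ℚ :=
  let m : ℕ := (-x.valuation).toNat
  (PadicInt.appr ⟨(p : ℚ_[p]) ^ m * x, norm_pow_mul_le_one p x⟩ m : ℚ) / (p : ℚ) ^ m

/-- The standard additive character `χ_p(y) = exp(2 π i {y}_p)`. -/
def chi (p : ℕ) [Fact p.Prime] (y : ℚ_[p]) : ℂ :=
  Complex.exp (2 * Real.pi * Complex.I * (fracPart p y : ℂ))

/-! ### The space `ℚ_p^n` with its maximum norm and its normalized Haar measure -/

instance instMeasurableSpacePadic (p : ℕ) [Fact p.Prime] : MeasurableSpace ℚ_[p] :=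
  borel ℚ_[p]

instance instBorelSpacePadic (p : ℕ) [Fact p.Prime] : BorelSpace ℚ_[p] := ⟨rfl⟩

/-- `ℚ_p^n`; the norm of this type is `‖x‖ = max_i |x_i|_p`. -/
abbrev QpN (p : ℕ) [Fact p.Prime] (n : ℕ) : Type := Fin n → ℚ_[p]

/-- The unit ball `ℤ_p^n`. -/
def unitBall (p : ℕ) [Fact p.Prime] (n : ℕ) : Set (QpN p n) := {x | ‖x‖ ≤ 1}

/-- The unit ball as a compact set with non-empty interior. -/
def unitBallCompact (p : ℕ) [Fact p.Prime] (n : ℕ) :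
    TopologicalSpace.PositiveCompacts (QpN p n) where
  carrier := unitBall p n
  isCompact' := by
    have h : unitBall p n = Metric.closedBall 0 1 := by
      ext x; simp [unitBall]
    rw [h]
    exact isCompact_closedBall 0 1
  interior_nonempty' := by
    refine ⟨0, mem_interior.2 ⟨Metric.ball 0 1, ?_, Metric.isOpen_ball, by simp⟩⟩
    intro x hx
    have : ‖x‖ < 1 := by simpa using hx
    exact this.le

/-- The Haar measure of `ℚ_p^n` for which `ℤ_p^n` has volume `1`. -/
def haar (p : ℕ) [Fact p.Prime] (n : ℕ) : Measure (QpN p n) :=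
  Measure.addHaarMeasure (unitBallCompact p n)

/-! ### Fourier transform, symbols and the operator `A_β` -/

/-- `(𝓕 φ)(ξ) = ∫ χ_p(ξ · x) φ(x) dx`. -/
def fourier (p : ℕ) [Fact p.Prime] (n : ℕ) (φ : QpN p n → ℂ) (ξ : QpN p n) : ℂ :=
  ∫ x, chi p (ξ ⬝ᵥ x) * φ x ∂(haar p n)

/-- `(𝓕⁻¹ ψ)(x) = ∫ χ_p(-ξ · x) ψ(ξ) dξ`. -/
def fourierInv (p : ℕ) [Fact p.Prime] (n : ℕ) (ψ : QpN p n → ℂ) (x : QpN p n) : ℂ :=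
  ∫ ξ, chi p (-(ξ ⬝ᵥ x)) * ψ ξ ∂(haar p n)

/-- The radial function `ξ ↦ g ‖ξ‖` on `ℚ_p^n` is comparable to `‖ξ‖ ^ β`. In particular it
takes values in `[0, ∞)`. -/
structure IsSymbol (p : ℕ) [Fact p.Prime] (n : ℕ) (β : ℝ) (g : ℝ → ℝ) : Prop where
  exponent_pos : 0 < β
  bounds : ∃ C₀ C₁ : ℝ, 0 < C₀ ∧ 0 < C₁ ∧
    ∀ ξ : QpN p n, C₀ * ‖ξ‖ ^ β ≤ g ‖ξ‖ ∧ g ‖ξ‖ ≤ C₁ * ‖ξ‖ ^ β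

/-- The pseudodifferential operator `φ ↦ 𝓕⁻¹ (A 𝓕 φ)` with symbol `A(ξ) = g ‖ξ‖`. -/
def pseudoDiff (p : ℕ) [Fact p.Prime] (n : ℕ) (g : ℝ → ℝ) (φ : QpN p n → ℂ) : QpN p n → ℂ :=
  fourierInv p n fun ξ => (g ‖ξ‖ : ℂ) * fourier p n φ ξ

/-- The space `𝓛₀(ℤ_p^n)` of test functions (locally constant functions of compact support)
supported in the unit ball and of integral zero. -/
structure IsLizorkinOnBall (p : ℕ) [Fact p.Prime] (n : ℕ) (φ : QpN p n → ℂ) : Prop where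
  locallyConstant : IsLocallyConstant φ
  compactSupport : HasCompactSupport φ
  support_subset : tsupport φ ⊆ unitBall p n
  integral_eq_zero : ∫ x, φ x ∂(haar p n) = 0

/-! ### The eigenfunctions -/

/-- The group `ℚ_p / ℤ_p`. -/
abbrev QpModZp (p : ℕ) [Fact p.Prime] : Type := ℚ_[p] ⧸ (PadicInt.subring p).toAddSubgroup

/-- `ω_{γ b k}(x) = p ^ (-n γ / 2) χ_p(p⁻¹ k · (p ^ γ x - b)) Ω(‖p ^ γ x - b‖)`, where `Ω` is the
indicator function of `[0, 1]`. -/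
def omega (p : ℕ) [Fact p.Prime] (n : ℕ) (γ : ℤ) (b : QpN p n) (k : Fin n → Fin p)
    (x : QpN p n) : ℂ :=
  let z : QpN p n := (p : ℚ_[p]) ^ γ • x - b
  let kp : QpN p n := fun i => ((k i : ℕ) : ℚ_[p])
  (((p : ℝ) ^ (-((n : ℝ) * (γ : ℝ)) / 2) : ℝ) : ℂ) * chi p ((p : ℚ_[p])⁻¹ * (kp ⬝ᵥ z)) *
    (unitBall p n).indicator 1 z

/-- `rep` picks a representative in `ℚ_p^n` of every element of `(ℚ_p / ℤ_p)^n`. -/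
def IsRepresentatives (p : ℕ) [Fact p.Prime] (n : ℕ)
    (rep : (Fin n → QpModZp p) → QpN p n) : Prop :=
  ∀ (b : Fin n → QpModZp p) (i : Fin n), (QuotientAddGroup.mk (rep b i) : QpModZp p) = b i

/-- The index set of the eigenfunctions `ω_{γ b k}` supported in the unit ball: triples `(γ, b, k)`
with `γ ∈ ℤ`, `b ∈ (ℚ_p / ℤ_p)^n`, `k ∈ {0, …, p - 1}^n`, `k ≠ 0` and
`supp ω_{γ b k} ⊆ ℤ_p^n`. -/
def BallIndex (p : ℕ) [Fact p.Prime] (n : ℕ) (rep : (Fin n → QpModZp p) → QpN p n) : Type :=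
  {q : ℤ × (Fin n → QpModZp p) × (Fin n → Fin p) //
    (∃ i, (q.2.2 i : ℕ) ≠ 0) ∧ tsupport (omega p n q.1 (rep q.2.1) q.2.2) ⊆ unitBall p n}

/-- The function `ω_{γ b k}` with index `(γ, b, k)`. -/
def eigenfun (p : ℕ) [Fact p.Prime] (n : ℕ) (rep : (Fin n → QpModZp p) → QpN p n)
    (q : BallIndex p n rep) : QpN p n → ℂ :=
  omega p n q.1.1 (rep q.1.2.1) q.1.2.2

/-- The number `λ_{γ b k} = A(p ^ (1 - γ))` with index `(γ, b, k)`. -/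
def eigenval (p : ℕ) [Fact p.Prime] (n : ℕ) (rep : (Fin n → QpModZp p) → QpN p n) (g : ℝ → ℝ)
    (q : BallIndex p n rep) : ℝ :=
  g ((p : ℝ) ^ (1 - q.1.1))

/-! ### The heat kernel on the unit ball -/

/-- The integrand `ξ ↦ χ_p(-x · ξ) exp(-t A(ξ))`. -/
def heatIntegrand (p : ℕ) [Fact p.Prime] (n : ℕ) (g : ℝ → ℝ) (x : QpN p n) (t : ℝ)
    (ξ : QpN p n) : ℂ :=
  chi p (-(x ⬝ᵥ ξ)) * (Real.exp (-t * g ‖ξ‖) : ℂ)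

/-- `K(x, t) = ∫_{ℚ_p^n ∖ ℤ_p^n} χ_p(-x · ξ) exp(-t A(ξ)) dξ`. -/
def heatKernel (p : ℕ) [Fact p.Prime] (n : ℕ) (g : ℝ → ℝ) (x : QpN p n) (t : ℝ) : ℂ :=
  ∫ ξ in (unitBall p n)ᶜ, heatIntegrand p n g x t ξ ∂(haar p n)

end

end PadicHeat

/-!
# The heat kernel on the unit ball of `ℚ_p^n`

Everything reduces to one integral: over the ball of radius `p ^ j` the character `w ↦ χ(ξ · w)`
integrates to the volume `p ^ (n j)` if `‖ξ‖ ≤ p ^ (-j)`, when it is trivial on the ball, and to `0`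
otherwise (`setIntegral_chi`). The vanishing is translation invariance; the volume follows from the
normalization of the measure by integrating the orthogonality relation
`∑ k, χ(p⁻¹ k · u) = p ^ n` or `0` of the characters of `(ℤ / p)^n` (`sum_chi_digitVec`), which
compares consecutive balls.

*Eigenfunctions.* Up to a constant, `ω_{γ b k}` is the character of frequency `η = p ^ (γ - 1) k` on
a ball of radius `p ^ γ`. Hence its Fourier transform is a character cut off to the ball of radius
`p ^ (-γ)` about `-η` (`fourier_omega`). As `‖η‖ = p ^ (1 - γ)` exceeds that radius, `‖ξ‖` equals
`p ^ (1 - γ)` on this ball, so the symbol acts there as a constant (`pseudoDiff_omega`), and `0` is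
not in this ball, so the integral of `ω_{γ b k}` vanishes.

*Kernel.* Cutting the complement of the unit ball into the spheres `‖ξ‖ = p ^ (N + 1)` writes
`K(x, t)` as a series in `N` (`hasSum_heatKernel`), which converges because `exp (-t A)` decays faster
than any geometric sequence in `N`. On the other side, for each `N` exactly one ball of radius
`p ^ (-N)` contains `x`, so only the indices with `γ = -N`, this ball, and arbitrary `k ≠ 0`
contribute to the expansion at `x`; by orthogonality their sum is the contribution of the `N`-th
sphere (`tsum_heatTerm`). Uniform convergence is the Weierstrass test: a term with `γ = -N` is at most
`p ^ (n N) exp (-ε A(p ^ (N + 1)))`, and there are at most `p ^ (n N) p ^ n` of them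
(`summable_ballIndex`).
-/

namespace PadicHeat

/-! ### The standard additive character -/

section Character

variable {p : ℕ} [Fact p.Prime]

theorem one_lt_prime_real : (1 : ℝ) < p := by
  exact_mod_cast (Fact.out : p.Prime).one_lt

theorem prime_pos_real : (0 : ℝ) < p := one_pos.trans one_lt_prime_real

theorem prime_ne_zero_padic : (p : ℚ_[p]) ≠ 0 := by
  exact_mod_cast (Fact.out : p.Prime).ne_zero

theorem dvd_of_norm_div_pow_le_one {a : ℤ} {m : ℕ}
    (h : ‖(a : ℚ_[p]) / (p : ℚ_[p]) ^ m‖ ≤ 1) : (p : ℤ) ^ m ∣ a := by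
  rw [← Padic.norm_int_le_pow_iff_dvd]
  have hp := prime_pos_real (p := p)
  rwa [norm_div, Padic.norm_p_pow, div_le_one (by positivity)] at h

theorem fracPart_eq_div (x : ℚ_[p]) : ∃ (a : ℤ) (m : ℕ),
    fracPart p x = a / (p : ℚ) ^ m ∧ ‖x - (a : ℚ_[p]) / (p : ℚ_[p]) ^ m‖ ≤ 1 := by
  set m : ℕ := (-x.valuation).toNat with hm
  set y : ℤ_[p] := ⟨(p : ℚ_[p]) ^ m * x, norm_pow_mul_le_one p x⟩ with hy
  refine ⟨(y.appr m : ℤ), m, by simp [fracPart, hm, hy], ?_⟩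
  have h := (PadicInt.norm_le_pow_iff_mem_span_pow _ m).2 (PadicInt.appr_spec m y)
  have hpm : (p : ℚ_[p]) ^ m ≠ 0 := pow_ne_zero _ prime_ne_zero_padic
  have he : x - ((y.appr m : ℤ) : ℚ_[p]) / (p : ℚ_[p]) ^ m
      = ((y - (y.appr m : ℤ_[p]) : ℤ_[p]) : ℚ_[p]) / (p : ℚ_[p]) ^ m := by
    push_cast
    rw [hy]
    field_simp
  have hp := prime_pos_real (p := p)
  rw [he, norm_div, Padic.norm_p_pow, div_le_one (by positivity)]
  exact h

theorem norm_add_le_one {x y : ℚ_[p]} (hx : ‖x‖ ≤ 1) (hy : ‖y‖ ≤ 1) : ‖x + y‖ ≤ 1 :=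
  (IsUltrametricDist.norm_add_le_max x y).trans (max_le hx hy)

/-- The character may be computed from any approximation `a / p ^ m` of its argument modulo
`ℤ_p`: two such approximations differ by a rational integer. -/
theorem chi_eq_exp {x : ℚ_[p]} {a : ℤ} {m : ℕ}
    (h : ‖x - (a : ℚ_[p]) / (p : ℚ_[p]) ^ m‖ ≤ 1) :
    chi p x = Complex.exp (2 * Real.pi * Complex.I * ((a : ℂ) / (p : ℂ) ^ m)) := by
  obtain ⟨a', m', hf, h'⟩ := fracPart_eq_div x
  have hp0 : (p : ℚ_[p]) ≠ 0 := prime_ne_zero_padic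
  have hpC : (p : ℂ) ≠ 0 := by exact_mod_cast (Fact.out : p.Prime).ne_zero
  have hd : ‖((a' * p ^ m - a * p ^ m' : ℤ) : ℚ_[p]) / (p : ℚ_[p]) ^ (m' + m)‖ ≤ 1 := by
    have := norm_add_le_one h (by rwa [norm_neg] : ‖-(x - (a' : ℚ_[p]) / (p : ℚ_[p]) ^ m')‖ ≤ 1)
    convert this using 2
    push_cast
    field_simp
    ring
  obtain ⟨c, hc⟩ := dvd_of_norm_div_pow_le_one hd
  have hcC : (a' : ℂ) * p ^ m - a * p ^ m' = p ^ (m' + m) * c := by exact_mod_cast hc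
  rw [chi, hf, Complex.exp_eq_exp_iff_exists_int]
  refine ⟨c, ?_⟩
  have key : (a' : ℂ) / (p : ℂ) ^ m' = (a : ℂ) / (p : ℂ) ^ m + c := by
    field_simp
    linear_combination hcC
  push_cast
  rw [key]
  ring

theorem exists_approx (x : ℚ_[p]) : ∃ (a : ℤ) (m : ℕ),
    ‖x - (a : ℚ_[p]) / (p : ℚ_[p]) ^ m‖ ≤ 1 :=
  let ⟨a, m, _, h⟩ := fracPart_eq_div x
  ⟨a, m, h⟩

theorem chi_add (x y : ℚ_[p]) : chi p (x + y) = chi p x * chi p y := by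
  obtain ⟨a, m, ha⟩ := exists_approx x
  obtain ⟨b, l, hb⟩ := exists_approx y
  have hp0 : (p : ℚ_[p]) ≠ 0 := prime_ne_zero_padic
  have hpC : (p : ℂ) ≠ 0 := by exact_mod_cast (Fact.out : p.Prime).ne_zero
  have h : ‖x + y - ((a * p ^ l + b * p ^ m : ℤ) : ℚ_[p]) / (p : ℚ_[p]) ^ (m + l)‖ ≤ 1 := by
    convert norm_add_le_one ha hb using 2
    push_cast
    field_simp
    ring
  rw [chi_eq_exp h, chi_eq_exp ha, chi_eq_exp hb, ← Complex.exp_add]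
  congr 1
  push_cast
  field_simp
  ring

theorem chi_eq_one_iff {x : ℚ_[p]} : chi p x = 1 ↔ ‖x‖ ≤ 1 := by
  constructor
  · intro h
    obtain ⟨a, m, ha⟩ := exists_approx x
    rw [chi_eq_exp ha, Complex.exp_eq_one_iff] at h
    obtain ⟨c, hc⟩ := h
    have hpC : (p : ℂ) ≠ 0 := by exact_mod_cast (Fact.out : p.Prime).ne_zero
    have h2 : (a : ℂ) / (p : ℂ) ^ m = c := by
      have := Complex.two_pi_I_ne_zero
      rw [mul_comm] at hc
      exact mul_right_cancel₀ this hc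
    rw [div_eq_iff (pow_ne_zero _ hpC)] at h2
    have h3 : a = c * p ^ m := by exact_mod_cast h2
    have h4 : (a : ℚ_[p]) / (p : ℚ_[p]) ^ m = c := by
      rw [h3]
      push_cast
      field_simp [prime_ne_zero_padic (p := p)]
    have := norm_add_le_one ha (h4 ▸ Padic.norm_int_le_one c)
    simpa using this
  · intro h
    rw [chi_eq_exp (a := 0) (m := 0) (by simpa using h)]
    simp

theorem chi_zero : chi p 0 = 1 := chi_eq_one_iff.2 (by simp)

theorem norm_chi (x : ℚ_[p]) : ‖chi p x‖ = 1 := by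
  have : 2 * Real.pi * Complex.I * (fracPart p x : ℂ)
      = ((2 * Real.pi * (fracPart p x : ℝ) : ℝ) : ℂ) * Complex.I := by
    push_cast; ring
  rw [chi, this, Complex.norm_exp_ofReal_mul_I]

theorem chi_ne_zero (x : ℚ_[p]) : chi p x ≠ 0 := by
  rw [← norm_ne_zero_iff, norm_chi]; exact one_ne_zero

theorem conj_chi (x : ℚ_[p]) : (starRingEnd ℂ) (chi p x) = chi p (-x) := by
  have h1 : chi p (-x) * chi p x = 1 := by rw [← chi_add, neg_add_cancel, chi_zero]
  have h2 : (starRingEnd ℂ) (chi p x) * chi p x = 1 := by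
    rw [mul_comm, Complex.mul_conj, Complex.normSq_eq_norm_sq, norm_chi]; simp
  exact mul_right_cancel₀ (chi_ne_zero x) (h2.trans h1.symm)

theorem chi_nat_mul (j : ℕ) (x : ℚ_[p]) : chi p (j * x) = chi p x ^ j := by
  induction j with
  | zero => simp [chi_zero]
  | succ j ih => rw [Nat.cast_succ, add_mul, one_mul, chi_add, ih, pow_succ]

theorem chi_sum {ι : Type*} (s : Finset ι) (f : ι → ℚ_[p]) :
    chi p (∑ i ∈ s, f i) = ∏ i ∈ s, chi p (f i) := by
  classical
  induction s using Finset.induction_on with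
  | empty => simp [chi_zero]
  | insert a s ha ih => rw [Finset.sum_insert ha, Finset.prod_insert ha, chi_add, ih]

theorem isLocallyConstant_chi : IsLocallyConstant (chi p) := by
  rw [IsLocallyConstant.iff_eventually_eq]
  intro x
  filter_upwards [Metric.closedBall_mem_nhds x one_pos] with y hy
  rw [mem_closedBall_iff_norm] at hy
  rw [← sub_add_cancel y x, chi_add, chi_eq_one_iff.2 hy, one_mul]

theorem sum_chi_digit {u : ℚ_[p]} (hu : ‖u‖ ≤ 1) :
    ∑ j : Fin p, chi p ((p : ℚ_[p])⁻¹ * (((j : ℕ) : ℚ_[p]) * u))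
      = if ‖u‖ < 1 then (p : ℂ) else 0 := by
  have hp := prime_pos_real (p := p)
  have hiff : chi p ((p : ℚ_[p])⁻¹ * u) = 1 ↔ ‖u‖ < 1 := by
    rw [chi_eq_one_iff, norm_mul, norm_inv, Padic.norm_p, inv_inv]
    have := Padic.norm_le_pow_iff_norm_lt_pow_add_one u (-1)
    rw [neg_add_cancel, zpow_zero, zpow_neg_one] at this
    rw [← this, ← le_inv_mul_iff₀ hp, mul_one]
  have hpow : chi p ((p : ℚ_[p])⁻¹ * u) ^ p = 1 := by
    rw [← chi_nat_mul, mul_inv_cancel_left₀ prime_ne_zero_padic]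
    exact chi_eq_one_iff.2 hu
  have hsum : ∑ j : Fin p, chi p ((p : ℚ_[p])⁻¹ * (((j : ℕ) : ℚ_[p]) * u))
      = ∑ j ∈ Finset.range p, chi p ((p : ℚ_[p])⁻¹ * u) ^ j := by
    rw [Finset.sum_range]
    refine Finset.sum_congr rfl fun j _ => ?_
    rw [← chi_nat_mul, mul_left_comm]
  rw [hsum]
  split_ifs with h
  · simp [hiff.2 h]
  · rw [geom_sum_eq (mt hiff.1 h), hpow, sub_self, zero_div]

end Character

section Digits

variable (p : ℕ) [Fact p.Prime] {n : ℕ}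

/-- The vector of `ℚ_p^n` whose coordinates are the digits `k i`. -/
noncomputable def digitVec (k : Fin n → Fin p) : QpN p n := fun i => ((k i : ℕ) : ℚ_[p])

variable {p}

/-- Orthogonality of the characters of `(ℤ / p)^n`. -/
theorem sum_chi_digitVec {u : QpN p n} (hu : ‖u‖ ≤ 1) :
    ∑ k : Fin n → Fin p, chi p ((p : ℚ_[p])⁻¹ * (digitVec p k ⬝ᵥ u))
      = if ‖u‖ < 1 then (p : ℂ) ^ n else 0 := by
  have hterm : ∀ k : Fin n → Fin p, chi p ((p : ℚ_[p])⁻¹ * (digitVec p k ⬝ᵥ u))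
      = ∏ i, chi p ((p : ℚ_[p])⁻¹ * (((k i : ℕ) : ℚ_[p]) * u i)) := by
    intro k
    rw [dotProduct, Finset.mul_sum, chi_sum]
    rfl
  have h := Finset.prod_univ_sum (fun _ : Fin n => (Finset.univ : Finset (Fin p)))
    (fun i j => chi p ((p : ℚ_[p])⁻¹ * (((j : ℕ) : ℚ_[p]) * u i)))
  rw [Fintype.piFinset_univ] at h
  rw [Finset.sum_congr rfl fun k _ => hterm k, ← h,
    Finset.prod_congr rfl fun i _ => sum_chi_digit ((norm_le_pi_norm u i).trans hu)]
  simp only [pi_norm_lt_iff one_pos]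
  split_ifs with hlt
  · simp [hlt]
  · push Not at hlt
    obtain ⟨i, hi⟩ := hlt
    exact Finset.prod_eq_zero (Finset.mem_univ i) (if_neg hi.not_gt)

theorem norm_digitVec {k : Fin n → Fin p} (hk : ∃ i, (k i : ℕ) ≠ 0) : ‖digitVec p k‖ = 1 := by
  refine le_antisymm ((pi_norm_le_iff_of_nonneg zero_le_one).2 fun i => ?_) ?_
  · exact_mod_cast Padic.norm_int_le_one (k i : ℤ)
  · obtain ⟨i, hi⟩ := hk
    refine le_of_eq_of_le ?_ (norm_le_pi_norm (digitVec p k) i)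
    symm
    rw [digitVec, Padic.norm_natCast_eq_one_iff]
    exact Nat.coprime_of_lt_prime hi (k i).2 Fact.out

theorem norm_dotProduct_le (ξ x : QpN p n) : ‖ξ ⬝ᵥ x‖ ≤ ‖ξ‖ * ‖x‖ := by
  refine IsUltrametricDist.norm_sum_le_of_forall_le_of_nonneg (by positivity) fun i _ => ?_
  rw [norm_mul]
  exact mul_le_mul (norm_le_pi_norm ξ i) (norm_le_pi_norm x i) (norm_nonneg _) (norm_nonneg _)

theorem norm_zpow_smul (j : ℤ) (x : QpN p n) : ‖(p : ℚ_[p]) ^ j • x‖ = (p : ℝ) ^ (-j) * ‖x‖ := by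
  rw [norm_smul, Padic.norm_p_zpow]

/-- The norm takes values in `{0} ∪ p ^ ℤ`. -/
theorem norm_le_zpow_iff_lt (x : QpN p n) (j : ℤ) :
    ‖x‖ ≤ (p : ℝ) ^ j ↔ ‖x‖ < (p : ℝ) ^ (j + 1) := by
  have hp := prime_pos_real (p := p)
  rw [pi_norm_le_iff_of_nonneg (by positivity), pi_norm_lt_iff (by positivity)]
  exact forall_congr' fun i => Padic.norm_le_pow_iff_norm_lt_pow_add_one _ _

end Digits

/-! ### Balls: their volume and the integrals of characters over them -/

section Balls

variable {p : ℕ} [Fact p.Prime] {n : ℕ}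

instance instIsAddHaarMeasureHaar : (haar p n).IsAddHaarMeasure := by
  unfold haar; infer_instance

variable (p n) in
/-- The ball of radius `p ^ j` about `0` in `ℚ_p^n`. -/
def zball (j : ℤ) : Set (QpN p n) := {x | ‖x‖ ≤ (p : ℝ) ^ j}

theorem mem_zball {j : ℤ} {x : QpN p n} : x ∈ zball p n j ↔ ‖x‖ ≤ (p : ℝ) ^ j := Iff.rfl

theorem zero_mem_zball (j : ℤ) : (0 : QpN p n) ∈ zball p n j := by
  rw [mem_zball, norm_zero]
  exact (zpow_pos prime_pos_real j).le

theorem zball_eq_closedBall (j : ℤ) : zball p n j = Metric.closedBall 0 ((p : ℝ) ^ j) := by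
  ext x; simp [zball]

theorem zball_zero : zball p n 0 = unitBall p n := by
  simp [zball, unitBall]

theorem isCompact_zball (j : ℤ) : IsCompact (zball p n j) := by
  rw [zball_eq_closedBall]; exact isCompact_closedBall _ _

theorem measurableSet_zball (j : ℤ) : MeasurableSet (zball p n j) :=
  (isCompact_zball j).isClosed.measurableSet

theorem isClopen_zball (j : ℤ) : IsClopen (zball p n j) := by
  rw [zball_eq_closedBall]
  exact IsUltrametricDist.isClopen_closedBall _ (zpow_pos prime_pos_real j).ne'

theorem add_mem_zball {j : ℤ} {x y : QpN p n} (hx : x ∈ zball p n j) (hy : y ∈ zball p n j) :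
    x + y ∈ zball p n j :=
  (IsUltrametricDist.norm_add_le_max x y).trans (max_le hx hy)

theorem neg_mem_zball {j : ℤ} {x : QpN p n} (hx : x ∈ zball p n j) : -x ∈ zball p n j := by
  rw [mem_zball, norm_neg]; exact hx

theorem sub_mem_zball {j : ℤ} {x y : QpN p n} (hx : x ∈ zball p n j) (hy : y ∈ zball p n j) :
    x - y ∈ zball p n j := by
  rw [sub_eq_add_neg]; exact add_mem_zball hx (neg_mem_zball hy)

theorem add_mem_zball_iff {j : ℤ} {x a : QpN p n} (ha : a ∈ zball p n j) :
    x + a ∈ zball p n j ↔ x ∈ zball p n j :=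
  ⟨fun h => by simpa using sub_mem_zball h ha, fun h => add_mem_zball h ha⟩

theorem zball_mono {i j : ℤ} (h : i ≤ j) : zball p n i ⊆ zball p n j := fun _ hx =>
  le_trans hx (zpow_le_zpow_right₀ one_lt_prime_real.le h)

theorem norm_lt_one_iff_mem_zball {u : QpN p n} : ‖u‖ < 1 ↔ u ∈ zball p n (-1) := by
  have := norm_le_zpow_iff_lt u (-1)
  rw [neg_add_cancel, zpow_zero] at this
  exact this.symm

theorem zpow_smul_mem_zball {i j : ℤ} {x : QpN p n} :
    (p : ℚ_[p]) ^ i • x ∈ zball p n j ↔ x ∈ zball p n (i + j) := by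
  have hp := prime_pos_real (p := p)
  rw [mem_zball, mem_zball, norm_zpow_smul, zpow_neg,
    inv_mul_le_iff₀ (zpow_pos hp i), zpow_add₀ hp.ne']

theorem measureReal_unitBall : (haar p n).real (unitBall p n) = 1 := by
  have h : (haar p n) (unitBall p n) = 1 :=
    Measure.addHaarMeasure_self (K₀ := unitBallCompact p n)
  rw [measureReal_def, h, ENNReal.toReal_one]

theorem integrableOn_zball_of_continuous {f : QpN p n → ℂ} (hf : Continuous f) (j : ℤ) :
    IntegrableOn f (zball p n j) (haar p n) :=
  hf.continuousOn.integrableOn_compact (isCompact_zball j)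

theorem continuous_chi : Continuous (chi p) := isLocallyConstant_chi.continuous

theorem continuous_chi_dotProduct (ξ : QpN p n) : Continuous fun x => chi p (ξ ⬝ᵥ x) := by
  unfold dotProduct
  exact continuous_chi.comp (by fun_prop)

theorem chi_dotProduct_eq_one {i j : ℤ} (hij : i + j ≤ 0) {ξ x : QpN p n}
    (hξ : ξ ∈ zball p n i) (hx : x ∈ zball p n j) : chi p (ξ ⬝ᵥ x) = 1 := by
  have hp := prime_pos_real (p := p)
  refine chi_eq_one_iff.2 ((norm_dotProduct_le ξ x).trans ?_)
  calc ‖ξ‖ * ‖x‖ ≤ (p : ℝ) ^ i * (p : ℝ) ^ j := mul_le_mul hξ hx (norm_nonneg _) (by positivity)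
    _ = (p : ℝ) ^ (i + j) := (zpow_add₀ hp.ne' _ _).symm
    _ ≤ 1 := zpow_le_one_of_nonpos₀ one_lt_prime_real.le hij

/-- A character that is nontrivial on a ball is detected by a multiple of a basis vector. -/
theorem exists_chi_dotProduct_ne_one {j : ℤ} {ξ : QpN p n} (hξ : ξ ∉ zball p n (-j)) :
    ∃ a ∈ zball p n j, chi p (ξ ⬝ᵥ a) ≠ 1 := by
  have hp := prime_pos_real (p := p)
  rw [mem_zball, pi_norm_le_iff_of_nonneg (by positivity)] at hξ
  push Not at hξ
  obtain ⟨i, hi⟩ := hξ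
  refine ⟨Pi.single i ((p : ℚ_[p]) ^ (-j)), ?_, ?_⟩
  · rw [mem_zball, Pi.norm_single, Padic.norm_p_zpow, neg_neg]
  · rw [dotProduct_single, Ne, chi_eq_one_iff, norm_mul, Padic.norm_p_zpow, neg_neg, not_le]
    calc (1 : ℝ) = (p : ℝ) ^ (-j) * (p : ℝ) ^ j := by
          rw [← zpow_add₀ hp.ne', neg_add_cancel, zpow_zero]
      _ < _ := by gcongr

/-- The integral over a ball of a character nontrivial on it vanishes: translating by an element
of the ball multiplies the integral by a number different from `1`. -/
theorem setIntegral_chi_eq_zero {j : ℤ} {ξ : QpN p n} (hξ : ξ ∉ zball p n (-j)) :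
    ∫ w in zball p n j, chi p (ξ ⬝ᵥ w) ∂(haar p n) = 0 := by
  obtain ⟨a, ha, hχ⟩ := exists_chi_dotProduct_ne_one hξ
  have h : ∫ w in zball p n j, chi p (ξ ⬝ᵥ w) ∂(haar p n)
      = chi p (ξ ⬝ᵥ a) * ∫ w in zball p n j, chi p (ξ ⬝ᵥ w) ∂(haar p n) := by
    rw [← integral_const_mul, ← integral_indicator (measurableSet_zball j),
      ← integral_indicator (measurableSet_zball j),
      ← integral_add_right_eq_self _ a]
    refine integral_congr_ae (Eventually.of_forall fun w => ?_)
    by_cases hw : w ∈ zball p n j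
    · simp only [Set.indicator_of_mem hw, Set.indicator_of_mem ((add_mem_zball_iff ha).2 hw)]
      rw [dotProduct_add, chi_add, mul_comm]
    · simp only [Set.indicator_of_notMem hw,
        Set.indicator_of_notMem (mt (add_mem_zball_iff ha).1 hw)]
  have h0 : (chi p (ξ ⬝ᵥ a) - 1) * ∫ w in zball p n j, chi p (ξ ⬝ᵥ w) ∂(haar p n) = 0 := by
    linear_combination -h
  exact (mul_eq_zero.1 h0).resolve_left (sub_ne_zero.2 hχ)

theorem setIntegral_chi_eq_measureReal {j : ℤ} {ξ : QpN p n} (hξ : ξ ∈ zball p n (-j)) :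
    ∫ w in zball p n j, chi p (ξ ⬝ᵥ w) ∂(haar p n) = (haar p n).real (zball p n j) := by
  rw [setIntegral_congr_fun (g := fun _ => (1 : ℂ)) (measurableSet_zball j) fun w hw =>
    chi_dotProduct_eq_one (neg_add_cancel j).le hξ hw]
  simp

/-- The frequency `p ^ (γ - 1) k` of `ω_{γ b k}`. -/
noncomputable def omegaFreq (γ : ℤ) (k : Fin n → Fin p) : QpN p n :=
  (p : ℚ_[p]) ^ (γ - 1) • digitVec p k

theorem norm_omegaFreq (γ : ℤ) {k : Fin n → Fin p} (hk : ∃ i, (k i : ℕ) ≠ 0) :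
    ‖omegaFreq γ k‖ = (p : ℝ) ^ (1 - γ) := by
  rw [omegaFreq, norm_zpow_smul, norm_digitVec hk, mul_one, neg_sub]

variable (p n) in
/-- The vector of digits all of which are `0`. -/
def zeroDigits : Fin n → Fin p := fun _ => ⟨0, (Fact.out : p.Prime).pos⟩

theorem ne_zeroDigits_iff {k : Fin n → Fin p} : k ≠ zeroDigits p n ↔ ∃ i, (k i : ℕ) ≠ 0 := by
  rw [Function.ne_iff]
  exact exists_congr fun i => Fin.ext_iff.not

theorem omegaFreq_zeroDigits (γ : ℤ) : omegaFreq γ (zeroDigits p n) = 0 := by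
  ext i; simp [omegaFreq, digitVec, zeroDigits]

/-- The characters `w ↦ χ(p ^ (γ - 1) k · w)` form the dual group of the quotient of the ball of
radius `p ^ γ` by the ball of radius `p ^ (γ - 1)`; this is their orthogonality relation. -/
theorem sum_chi_omegaFreq {γ : ℤ} {w : QpN p n} (hw : w ∈ zball p n γ) :
    ∑ k, chi p (omegaFreq γ k ⬝ᵥ w) = (zball p n (γ - 1)).indicator (fun _ => (p : ℂ) ^ n) w := by
  have hu : (p : ℚ_[p]) ^ γ • w ∈ zball p n 0 := by
    rw [zpow_smul_mem_zball, add_zero]; exact hw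
  have h := sum_chi_digitVec (p := p) (u := (p : ℚ_[p]) ^ γ • w) (by simpa [zball] using hu)
  have hiff : ‖(p : ℚ_[p]) ^ γ • w‖ < 1 ↔ w ∈ zball p n (γ - 1) := by
    rw [norm_lt_one_iff_mem_zball, zpow_smul_mem_zball, ← sub_eq_add_neg]
  classical
  rw [if_congr hiff rfl rfl] at h
  rw [Set.indicator_apply, ← h]
  refine Finset.sum_congr rfl fun k _ => ?_
  simp only [omegaFreq, smul_dotProduct, dotProduct_smul, smul_eq_mul]
  rw [← mul_assoc, ← zpow_neg_one, ← zpow_add₀ prime_ne_zero_padic, neg_add_eq_sub]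

/-- Integrating the orthogonality relation over a ball compares the volumes of two consecutive
balls. -/
theorem measureReal_zball_eq (j : ℤ) :
    (haar p n).real (zball p n j) = (p : ℝ) ^ n * (haar p n).real (zball p n (j - 1)) := by
  have h1 : ∫ w in zball p n j, ∑ k, chi p (omegaFreq j k ⬝ᵥ w) ∂(haar p n)
      = (p : ℂ) ^ n * (haar p n).real (zball p n (j - 1)) := by
    rw [setIntegral_congr_fun (measurableSet_zball j) fun w hw => sum_chi_omegaFreq hw,
      setIntegral_indicator (measurableSet_zball _),
      Set.inter_eq_right.2 (zball_mono (by lia))]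
    simp [mul_comm]
  have h2 : ∫ w in zball p n j, ∑ k, chi p (omegaFreq j k ⬝ᵥ w) ∂(haar p n)
      = (haar p n).real (zball p n j) := by
    rw [integral_finsetSum _ fun k _ =>
      integrableOn_zball_of_continuous (continuous_chi_dotProduct _) j,
      Finset.sum_eq_single (zeroDigits p n), omegaFreq_zeroDigits]
    · exact setIntegral_chi_eq_measureReal (zero_mem_zball _)
    · intro k _ hk
      refine setIntegral_chi_eq_zero ?_
      rw [mem_zball, norm_omegaFreq j (ne_zeroDigits_iff.1 hk), not_le]
      exact zpow_lt_zpow_right₀ one_lt_prime_real (by lia)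
    · simp
  exact_mod_cast h2.symm.trans h1

theorem measureReal_zball (j : ℤ) : (haar p n).real (zball p n j) = ((p : ℝ) ^ n) ^ j := by
  have hp := prime_pos_real (p := p)
  have hp' : (p : ℝ) ^ n ≠ 0 := by positivity
  induction j using Int.induction_on with
  | zero => rw [zball_zero, measureReal_unitBall, zpow_zero]
  | succ i ih => rw [measureReal_zball_eq, add_sub_cancel_right, ih, zpow_add_one₀ hp', mul_comm]
  | pred i ih =>
    rw [measureReal_zball_eq] at ih
    rw [zpow_sub_one₀ hp', ← ih]
    field_simp

open Classical in
theorem setIntegral_chi (j : ℤ) (ξ : QpN p n) :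
    ∫ w in zball p n j, chi p (ξ ⬝ᵥ w) ∂(haar p n)
      = if ξ ∈ zball p n (-j) then ((p : ℂ) ^ n) ^ j else 0 := by
  split_ifs with h
  · rw [setIntegral_chi_eq_measureReal h, measureReal_zball]; push_cast; rfl
  · exact setIntegral_chi_eq_zero h

end Balls

/-! ### The functions `ω_{γ b k}` as eigenfunctions -/

section Eigenfunctions

variable {p : ℕ} [Fact p.Prime] {n : ℕ}

/-- The centre `p ^ (-γ) b` of the ball on which `ω_{γ b k}` lives. -/
noncomputable def omegaCenter (γ : ℤ) (b : QpN p n) : QpN p n := (p : ℚ_[p]) ^ (-γ) • b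

variable (p n) in
/-- The normalizing factor `p ^ (-n γ / 2)` of `ω_{γ b k}`. -/
noncomputable def omegaCoeff (γ : ℤ) : ℝ := (p : ℝ) ^ (-((n : ℝ) * (γ : ℝ)) / 2)

theorem omegaCoeff_pos (γ : ℤ) : 0 < omegaCoeff p n γ := Real.rpow_pos_of_pos prime_pos_real _

theorem omegaCoeff_mul_self (γ : ℤ) :
    omegaCoeff p n γ * omegaCoeff p n γ = ((p : ℝ) ^ n) ^ (-γ) := by
  have hp := prime_pos_real (p := p)
  rw [omegaCoeff, ← Real.rpow_add hp, ← Real.rpow_natCast, ← Real.rpow_intCast,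
    ← Real.rpow_mul hp.le]
  congr 1
  push_cast
  ring

theorem zpow_smul_sub_eq (γ : ℤ) (b x : QpN p n) :
    (p : ℚ_[p]) ^ γ • x - b = (p : ℚ_[p]) ^ γ • (x - omegaCenter γ b) := by
  rw [omegaCenter, smul_sub, smul_smul, ← zpow_add₀ prime_ne_zero_padic, add_neg_cancel, zpow_zero,
    one_smul]

theorem zpow_smul_sub_mem_unitBall {γ : ℤ} {b x : QpN p n} :
    (p : ℚ_[p]) ^ γ • x - b ∈ unitBall p n ↔ x - omegaCenter γ b ∈ zball p n γ := by
  rw [zpow_smul_sub_eq, ← zball_zero, zpow_smul_mem_zball, add_zero]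

theorem omega_of_mem {γ : ℤ} {b x : QpN p n} (k : Fin n → Fin p)
    (h : x - omegaCenter γ b ∈ zball p n γ) :
    omega p n γ b k x = omegaCoeff p n γ * chi p (omegaFreq γ k ⬝ᵥ (x - omegaCenter γ b)) := by
  simp only [omega, Set.indicator_of_mem (zpow_smul_sub_mem_unitBall.2 h), Pi.one_apply, mul_one]
  rw [zpow_smul_sub_eq, omegaFreq, smul_dotProduct, dotProduct_smul, smul_eq_mul, smul_eq_mul,
    ← mul_assoc, ← zpow_neg_one, ← zpow_add₀ prime_ne_zero_padic, neg_add_eq_sub]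
  rfl

theorem omega_of_notMem {γ : ℤ} {b x : QpN p n} (k : Fin n → Fin p)
    (h : x - omegaCenter γ b ∉ zball p n γ) : omega p n γ b k x = 0 := by
  simp only [omega, Set.indicator_of_notMem (mt zpow_smul_sub_mem_unitBall.1 h), mul_zero]

theorem norm_omega_le (γ : ℤ) (b : QpN p n) (k : Fin n → Fin p) (x : QpN p n) :
    ‖omega p n γ b k x‖ ≤ omegaCoeff p n γ := by
  by_cases h : x - omegaCenter γ b ∈ zball p n γ
  · rw [omega_of_mem k h, norm_mul, norm_chi, mul_one, Complex.norm_real,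
      Real.norm_of_nonneg (omegaCoeff_pos γ).le]
  · rw [omega_of_notMem k h, norm_zero]
    exact (omegaCoeff_pos γ).le

theorem support_omega (γ : ℤ) (b : QpN p n) (k : Fin n → Fin p) :
    Function.support (omega p n γ b k) = {x | x - omegaCenter γ b ∈ zball p n γ} := by
  ext x
  rw [Function.mem_support, Set.mem_ofPred_eq]
  refine ⟨not_imp_comm.1 (omega_of_notMem k), fun h => ?_⟩
  rw [omega_of_mem k h]
  exact mul_ne_zero (Complex.ofReal_ne_zero.2 (omegaCoeff_pos γ).ne') (chi_ne_zero _)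

theorem isClopen_support_omega (γ : ℤ) (b : QpN p n) (k : Fin n → Fin p) :
    IsClopen (Function.support (omega p n γ b k)) := by
  rw [support_omega]
  exact (isClopen_zball γ).preimage (by fun_prop : Continuous fun x => x - omegaCenter γ b)

theorem tsupport_omega (γ : ℤ) (b : QpN p n) (k : Fin n → Fin p) :
    tsupport (omega p n γ b k) = {x | x - omegaCenter γ b ∈ zball p n γ} := by
  rw [tsupport, (isClopen_support_omega γ b k).isClosed.closure_eq, support_omega]

theorem isLocallyConstant_omega (γ : ℤ) (b : QpN p n) (k : Fin n → Fin p) :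
    IsLocallyConstant (omega p n γ b k) := by
  have hχ : IsLocallyConstant
      fun x : QpN p n => chi p (omegaFreq γ k ⬝ᵥ (x - omegaCenter γ b)) := by
    refine isLocallyConstant_chi.comp_continuous
      (f := fun x : QpN p n => omegaFreq γ k ⬝ᵥ (x - omegaCenter γ b)) ?_
    unfold dotProduct
    fun_prop
  rw [IsLocallyConstant.iff_eventually_eq] at hχ ⊢
  have hclopen := isClopen_support_omega γ b k
  rw [support_omega] at hclopen
  intro x
  by_cases h : x - omegaCenter γ b ∈ zball p n γ
  · filter_upwards [hχ x, hclopen.isOpen.mem_nhds h] with y hy hy'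
    rw [omega_of_mem k h, omega_of_mem k hy', hy]
  · filter_upwards [hclopen.compl.isOpen.mem_nhds h] with y hy
    rw [omega_of_notMem k h, omega_of_notMem k hy]

open Classical in
/-- The Fourier transform of `ω_{γ b k}` is a multiple of a character, cut off to the ball of
radius `p ^ (-γ)` about `-p ^ (γ - 1) k`. -/
theorem fourier_omega (γ : ℤ) (b : QpN p n) (k : Fin n → Fin p) (ξ : QpN p n) :
    fourier p n (omega p n γ b k) ξ = omegaCoeff p n γ * chi p (ξ ⬝ᵥ omegaCenter γ b) *
      if ξ + omegaFreq γ k ∈ zball p n (-γ) then ((p : ℂ) ^ n) ^ γ else 0 := by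
  rw [← setIntegral_chi, ← integral_const_mul, ← integral_indicator (measurableSet_zball γ),
    ← integral_sub_right_eq_self _ (omegaCenter γ b), fourier]
  refine integral_congr_ae (Eventually.of_forall fun x => ?_)
  by_cases h : x - omegaCenter γ b ∈ zball p n γ
  · simp only [Set.indicator_of_mem h, omega_of_mem k h]
    rw [add_dotProduct, chi_add, mul_left_comm, ← mul_assoc _ (chi p (ξ ⬝ᵥ x)) _, ← mul_assoc,
      mul_assoc (_ : ℂ) (chi p (ξ ⬝ᵥ omegaCenter γ b)), ← chi_add, ← dotProduct_add,
      add_sub_cancel]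
  · simp only [Set.indicator_of_notMem h, omega_of_notMem k h, mul_zero]

theorem norm_eq_of_add_omegaFreq_mem {γ : ℤ} {k : Fin n → Fin p} (hk : ∃ i, (k i : ℕ) ≠ 0)
    {ξ : QpN p n} (h : ξ + omegaFreq γ k ∈ zball p n (-γ)) : ‖ξ‖ = (p : ℝ) ^ (1 - γ) := by
  rw [← norm_omegaFreq γ hk]
  refine IsUltrametricDist.norm_eq_of_add_norm_lt_max (lt_max_of_lt_right ?_)
  rw [norm_omegaFreq γ hk]
  exact (mem_zball.1 h).trans_lt (zpow_lt_zpow_right₀ one_lt_prime_real (by lia))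

theorem integral_omega {γ : ℤ} {k : Fin n → Fin p} (hk : ∃ i, (k i : ℕ) ≠ 0) (b : QpN p n) :
    ∫ x, omega p n γ b k x ∂(haar p n) = 0 := by
  have h := fourier_omega γ b k 0
  have h0 : (0 : QpN p n) + omegaFreq γ k ∉ zball p n (-γ) := fun h => by
    have := norm_eq_of_add_omegaFreq_mem hk h
    rw [norm_zero] at this
    exact (zpow_pos prime_pos_real _).ne this
  rw [if_neg h0, mul_zero] at h
  simpa [fourier, chi_zero] using h

/-- The symbol is constant on the support of the Fourier transform of `ω_{γ b k}`. -/
theorem pseudoDiff_omega (g : ℝ → ℝ) (γ : ℤ) (b : QpN p n) {k : Fin n → Fin p}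
    (hk : ∃ i, (k i : ℕ) ≠ 0) (x : QpN p n) :
    pseudoDiff p n g (omega p n γ b k) x = g ((p : ℝ) ^ (1 - γ)) * omega p n γ b k x := by
  classical
  have hp : ((p : ℂ) ^ n) ≠ 0 := pow_ne_zero _ (by exact_mod_cast (Fact.out : p.Prime).ne_zero)
  set x₀ := omegaCenter γ b with hx₀
  set η := omegaFreq γ k with hη
  have hint : pseudoDiff p n g (omega p n γ b k) x
      = ∫ v in zball p n (-γ), (g ((p : ℝ) ^ (1 - γ)) * omegaCoeff p n γ * ((p : ℂ) ^ n) ^ γ *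
          chi p (η ⬝ᵥ (x - x₀))) * chi p ((x₀ - x) ⬝ᵥ v) ∂(haar p n) := by
    rw [← integral_indicator (measurableSet_zball _), ← integral_add_right_eq_self _ η]
    refine integral_congr_ae (Eventually.of_forall fun ξ => ?_)
    simp only [fourier_omega, ← hη, ← hx₀]
    by_cases h : ξ + η ∈ zball p n (-γ)
    · rw [if_pos h, Set.indicator_of_mem h, norm_eq_of_add_omegaFreq_mem hk h]
      have hχ : chi p (-(ξ ⬝ᵥ x)) * chi p (ξ ⬝ᵥ x₀)
          = chi p (η ⬝ᵥ (x - x₀)) * chi p ((x₀ - x) ⬝ᵥ (ξ + η)) := by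
        rw [← chi_add, ← chi_add, dotProduct_comm (x₀ - x)]
        congr 1
        simp only [add_dotProduct, dotProduct_sub]
        ring
      linear_combination (g ((p : ℝ) ^ (1 - γ)) * omegaCoeff p n γ * ((p : ℂ) ^ n) ^ γ : ℂ) * hχ
    · rw [if_neg h, Set.indicator_of_notMem h, mul_zero, mul_zero, mul_zero]
  rw [hint, integral_const_mul, setIntegral_chi, neg_neg]
  by_cases h : x - x₀ ∈ zball p n γ
  · rw [if_pos (by rw [← neg_sub]; exact neg_mem_zball h), omega_of_mem k h, zpow_neg, ← hη, ← hx₀]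
    field_simp
  · rw [if_neg fun h' => h (by rw [← neg_sub]; exact neg_mem_zball h'), omega_of_notMem k h]
    simp

end Eigenfunctions

/-! ### The index set -/

section Index

variable {p : ℕ} [Fact p.Prime] {n : ℕ}

theorem ball_subset_unitBall_iff {γ : ℤ} (hn : 0 < n) {a : QpN p n} :
    {x | x - a ∈ zball p n γ} ⊆ unitBall p n ↔ γ ≤ 0 ∧ a ∈ unitBall p n := by
  have hp := prime_pos_real (p := p)
  rw [← zball_zero]
  constructor
  · intro h
    have ha : a ∈ zball p n 0 := h (by simpa using zero_mem_zball γ)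
    refine ⟨?_, ha⟩
    let v : QpN p n := Pi.single ⟨0, hn⟩ ((p : ℚ_[p]) ^ (-γ))
    have hv : ‖v‖ = (p : ℝ) ^ γ := by rw [Pi.norm_single, Padic.norm_p_zpow, neg_neg]
    have h1 : v + a ∈ zball p n 0 := h (by simp [zball, hv])
    rw [add_mem_zball_iff ha, mem_zball, hv] at h1
    exact (zpow_le_zpow_iff_right₀ one_lt_prime_real).1 h1
  · rintro ⟨hγ, ha⟩ x hx
    rw [← sub_add_cancel x a]
    exact add_mem_zball (zball_mono hγ hx) ha

end Index

/-! ### The heat kernel as a sum over spheres -/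

theorem summable_pow_mul_exp_neg (A : ℝ) {r c : ℝ} (hA : 0 ≤ A) (hr : 1 < r) (hc : 0 < c) :
    Summable fun j : ℕ => A ^ j * Real.exp (-(c * r ^ j)) := by
  -- `exp` grows faster than the power with exponent `m`, and `m` is so large that `A < r ^ m`.
  obtain ⟨m, hm⟩ := pow_unbounded_of_one_lt A hr
  have hr0 : 0 < r := one_pos.trans hr
  have hgeom : Summable fun j : ℕ => (m.factorial / c ^ m : ℝ) * (A / r ^ m) ^ j :=
    (summable_geometric_of_lt_one (by positivity)
      ((div_lt_one (by positivity)).2 hm)).mul_left _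
  refine hgeom.of_nonneg_of_le (fun j => by positivity) fun j => ?_
  have h := Real.pow_div_factorial_le_exp (c * r ^ j) (by positivity) m
  have hpos : 0 < (c * r ^ j) ^ m / m.factorial := by positivity
  rw [Real.exp_neg]
  calc A ^ j * (Real.exp (c * r ^ j))⁻¹
      ≤ A ^ j * ((c * r ^ j) ^ m / m.factorial)⁻¹ := by gcongr
    _ = (m.factorial / c ^ m : ℝ) * (A / r ^ m) ^ j := by
      rw [inv_div, mul_pow, div_pow, ← pow_mul, ← pow_mul, mul_comm j m]
      field_simp

section HeatKernel

variable {p : ℕ} [Fact p.Prime] {n : ℕ} {β : ℝ} {g : ℝ → ℝ}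

theorem IsSymbol.exists_lower_bound (hn : 0 < n) (hg : IsSymbol p n β g) :
    ∃ C : ℝ, 0 < C ∧ ∀ j : ℤ, C * ((p : ℝ) ^ β) ^ j ≤ g ((p : ℝ) ^ j) := by
  have hp := prime_pos_real (p := p)
  obtain ⟨C, _, hC, _, h⟩ := hg.bounds
  refine ⟨C, hC, fun j => ?_⟩
  have hv : ‖(Pi.single ⟨0, hn⟩ ((p : ℚ_[p]) ^ (-j)) : QpN p n)‖ = (p : ℝ) ^ j := by
    rw [Pi.norm_single, Padic.norm_p_zpow, neg_neg]
  have := (h (Pi.single ⟨0, hn⟩ ((p : ℚ_[p]) ^ (-j)))).1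
  rw [hv] at this
  refine le_of_eq_of_le ?_ this
  rw [← Real.rpow_intCast, ← Real.rpow_intCast, ← Real.rpow_mul hp.le, ← Real.rpow_mul hp.le,
    mul_comm β]

theorem IsSymbol.nonneg (hn : 0 < n) (hg : IsSymbol p n β g) (j : ℤ) : 0 ≤ g ((p : ℝ) ^ j) := by
  have hp := prime_pos_real (p := p)
  obtain ⟨C, hC, h⟩ := hg.exists_lower_bound hn
  exact le_trans (by positivity) (h j)

theorem IsSymbol.summable_pow_mul_exp (hn : 0 < n) (hg : IsSymbol p n β g) {A ε : ℝ} (hA : 0 ≤ A)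
    (hε : 0 < ε) :
    Summable fun j : ℕ => A ^ j * Real.exp (-(g ((p : ℝ) ^ ((j : ℤ) + 1)) * ε)) := by
  have hp := prime_pos_real (p := p)
  obtain ⟨C, hC, h⟩ := hg.exists_lower_bound hn
  have hr : 1 < (p : ℝ) ^ β := Real.one_lt_rpow one_lt_prime_real hg.exponent_pos
  refine (summable_pow_mul_exp_neg A hA hr (c := C * (p : ℝ) ^ β * ε)
    (by positivity)).of_nonneg_of_le (fun j => by positivity) fun j => ?_
  have := h (j + 1)
  rw [zpow_add_one₀ (by positivity), zpow_natCast] at this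
  refine mul_le_mul_of_nonneg_left (Real.exp_le_exp.2 (neg_le_neg ?_)) (by positivity)
  calc C * (p : ℝ) ^ β * ε * ((p : ℝ) ^ β) ^ j
      = C * (((p : ℝ) ^ β) ^ j * (p : ℝ) ^ β) * ε := by ring
    _ ≤ _ := by gcongr

variable (p n) in
/-- The sphere of radius `p ^ (j + 1)` about `0`, as a difference of balls. -/
def sphere (j : ℕ) : Set (QpN p n) := zball p n (j + 1) \ zball p n j

theorem measurableSet_sphere (j : ℕ) : MeasurableSet (sphere p n j) :=
  (measurableSet_zball _).diff (measurableSet_zball _)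

theorem norm_of_mem_sphere {j : ℕ} {ξ : QpN p n} (h : ξ ∈ sphere p n j) :
    ‖ξ‖ = (p : ℝ) ^ ((j : ℤ) + 1) :=
  le_antisymm h.1 (not_lt.1 fun hlt => h.2 ((norm_le_zpow_iff_lt ξ j).2 hlt))

theorem pairwise_disjoint_sphere : Pairwise (Function.onFun Disjoint (sphere p n)) := by
  intro i j hij
  refine Set.disjoint_left.2 fun ξ hi hj => hij ?_
  have := (norm_of_mem_sphere hi).symm.trans (norm_of_mem_sphere hj)
  have := zpow_right_injective₀ prime_pos_real one_lt_prime_real.ne' this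
  lia

theorem iUnion_sphere : ⋃ j, sphere p n j = (unitBall p n)ᶜ := by
  ext ξ
  rw [Set.mem_iUnion, Set.mem_compl_iff, ← zball_zero]
  constructor
  · rintro ⟨j, hj⟩ h
    exact hj.2 (zball_mono (by positivity) h)
  · intro h
    classical
    have hex : ∃ j : ℕ, ξ ∈ zball p n j := by
      obtain ⟨j, hj⟩ := pow_unbounded_of_one_lt ‖ξ‖ (one_lt_prime_real (p := p))
      exact ⟨j, by rw [mem_zball, zpow_natCast]; exact hj.le⟩
    have h0 : Nat.find hex ≠ 0 := fun h0 => h (by simpa [h0] using Nat.find_spec hex)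
    obtain ⟨j, hj⟩ := Nat.exists_eq_succ_of_ne_zero h0
    refine ⟨j, ?_, Nat.find_min hex (by lia)⟩
    have := Nat.find_spec hex
    rw [hj] at this
    exact_mod_cast this

theorem heatIntegrand_of_mem_sphere (g : ℝ → ℝ) (x : QpN p n) (t : ℝ) {j : ℕ} {ξ : QpN p n}
    (h : ξ ∈ sphere p n j) : heatIntegrand p n g x t ξ
      = Real.exp (-(g ((p : ℝ) ^ ((j : ℤ) + 1)) * t)) * chi p ((-x) ⬝ᵥ ξ) := by
  rw [heatIntegrand, norm_of_mem_sphere h, neg_dotProduct, mul_comm, neg_mul, mul_comm t]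

theorem integrableOn_sphere (g : ℝ → ℝ) (x : QpN p n) (t : ℝ) (j : ℕ) :
    IntegrableOn (heatIntegrand p n g x t) (sphere p n j) (haar p n) := by
  rw [integrableOn_congr_fun (fun ξ hξ => heatIntegrand_of_mem_sphere g x t hξ)
    (measurableSet_sphere j)]
  exact ((integrableOn_zball_of_continuous (continuous_chi_dotProduct _) _).mono_set
    Set.sdiff_subset).const_mul _

theorem integrableOn_heatIntegrand (hn : 0 < n) (hg : IsSymbol p n β g) (x : QpN p n) {t : ℝ}
    (ht : 0 < t) : IntegrableOn (heatIntegrand p n g x t) (unitBall p n)ᶜ (haar p n) := by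
  have hp := prime_pos_real (p := p)
  rw [← iUnion_sphere]
  refine integrableOn_iUnion_of_summable_integral_norm (fun j => integrableOn_sphere g x t j) ?_
  refine ((hg.summable_pow_mul_exp hn (A := (p : ℝ) ^ n) (by positivity) ht).mul_left
    ((p : ℝ) ^ n)).of_nonneg_of_le (fun j => integral_nonneg fun _ => norm_nonneg _) fun j => ?_
  have hnorm : ∀ ξ ∈ sphere p n j, ‖heatIntegrand p n g x t ξ‖
      = Real.exp (-(g ((p : ℝ) ^ ((j : ℤ) + 1)) * t)) := fun ξ hξ => by
    rw [heatIntegrand_of_mem_sphere g x t hξ, norm_mul, norm_chi, mul_one, Complex.norm_real,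
      Real.norm_of_nonneg (Real.exp_pos _).le]
  rw [setIntegral_congr_fun (measurableSet_sphere j) hnorm, setIntegral_const, smul_eq_mul,
    ← mul_assoc]
  gcongr
  calc (haar p n).real (sphere p n j) ≤ (haar p n).real (zball p n (j + 1)) :=
        measureReal_mono Set.sdiff_subset (isCompact_zball _).measure_lt_top.ne
    _ = (p : ℝ) ^ n * ((p : ℝ) ^ n) ^ j := by
        rw [measureReal_zball, zpow_add_one₀ (by positivity), zpow_natCast, mul_comm]

open Classical in
theorem hasSum_heatKernel (hn : 0 < n) (hg : IsSymbol p n β g) (x : QpN p n) {t : ℝ}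
    (ht : 0 < t) :
    HasSum (fun j : ℕ => (Real.exp (-(g ((p : ℝ) ^ ((j : ℤ) + 1)) * t)) : ℂ) *
      ((if x ∈ zball p n (-(j + 1)) then ((p : ℂ) ^ n) ^ (j + 1) else 0) -
        if x ∈ zball p n (-j) then ((p : ℂ) ^ n) ^ j else 0)) (heatKernel p n g x t) := by
  have h := integrableOn_heatIntegrand hn hg x ht
  rw [← iUnion_sphere] at h
  have hs := hasSum_integral_iUnion measurableSet_sphere pairwise_disjoint_sphere h
  rw [iUnion_sphere] at hs
  refine hs.congr_fun fun j => ?_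
  have hmem : ∀ i : ℤ, -x ∈ zball p n i ↔ x ∈ zball p n i := fun i => by
    rw [mem_zball, norm_neg, mem_zball]
  rw [setIntegral_congr_fun (measurableSet_sphere j) fun ξ hξ =>
      heatIntegrand_of_mem_sphere g x t hξ, integral_const_mul, sphere,
    setIntegral_sdiff (measurableSet_zball _)
      (integrableOn_zball_of_continuous (continuous_chi_dotProduct _) _)
      (zball_mono (by lia)), setIntegral_chi, setIntegral_chi]
  simp only [hmem]
  norm_cast

end HeatKernel

section Index

variable {p : ℕ} [Fact p.Prime] {n : ℕ} {rep : (Fin n → QpModZp p) → QpN p n}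

theorem BallIndex.mem_and_le (q : BallIndex p n rep) :
    q.1.1 ≤ 0 ∧ omegaCenter q.1.1 (rep q.1.2.1) ∈ unitBall p n := by
  obtain ⟨⟨i, -⟩, h⟩ := q.2
  rw [tsupport_omega] at h
  exact (ball_subset_unitBall_iff i.pos).1 h

theorem mk_eq_mk_iff {a b : ℚ_[p]} : (QuotientAddGroup.mk a : QpModZp p) = QuotientAddGroup.mk b ↔
    ‖b - a‖ ≤ 1 := by
  rw [QuotientAddGroup.eq, neg_add_eq_sub]
  rfl

variable (p n) in
/-- The class of `p ^ γ x` in `(ℚ_p / ℤ_p)^n`. -/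
noncomputable def scaledClass (γ : ℤ) (x : QpN p n) : Fin n → QpModZp p :=
  fun i => QuotientAddGroup.mk (((p : ℚ_[p]) ^ γ • x) i)

/-- For fixed `γ`, the balls on which the functions `ω_{γ b k}` live partition `ℚ_p^n`. -/
theorem sub_omegaCenter_mem_iff (hrep : IsRepresentatives p n rep) {γ : ℤ}
    {b : Fin n → QpModZp p} {x : QpN p n} :
    x - omegaCenter γ (rep b) ∈ zball p n γ ↔ b = scaledClass p n γ x := by
  rw [← zpow_smul_sub_mem_unitBall, unitBall, Set.mem_ofPred_eq,
    pi_norm_le_iff_of_nonneg zero_le_one, funext_iff]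
  refine forall_congr' fun i => ?_
  rw [← hrep b i, scaledClass, mk_eq_mk_iff]
  rfl

theorem exists_digit_approx (N : ℕ) (y : ℚ_[p]) :
    ∃ a : ℕ, a < p ^ N ∧ (‖y‖ ≤ 1 → ‖y - a‖ ≤ (p : ℝ) ^ (-(N : ℤ))) := by
  by_cases h : ‖y‖ ≤ 1
  · let z : ℤ_[p] := ⟨y, h⟩
    refine ⟨z.appr N, PadicInt.appr_lt z N, fun _ => ?_⟩
    exact (PadicInt.norm_le_pow_iff_mem_span_pow _ N).2 (PadicInt.appr_spec N z)
  · exact ⟨0, pow_pos (Fact.out : p.Prime).pos N, fun h' => absurd h' h⟩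

/-- Since the unit ball contains `p ^ (n N)` balls of radius `p ^ (-N)`, there are at most
`p ^ (n N) * p ^ n` indices with `γ = -N`. A weight of rapid decay in `N` is therefore summable. -/
theorem summable_ballIndex (hrep : IsRepresentatives p n rep) {w : ℤ → ℝ} (hw : ∀ γ, 0 ≤ w γ)
    (hsum : Summable fun N : ℕ => ((p : ℝ) ^ n) ^ N * w (-N)) :
    Summable fun q : BallIndex p n rep => w q.1.1 := by
  classical
  choose d hd_lt hd using fun (N : ℕ) (y : ℚ_[p]) => exists_digit_approx (p := p) N y
  -- An index is determined by `N = -γ`, by the first `N` digits of the coordinates of the centre,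
  -- and by `k`.
  let c : BallIndex p n rep → QpN p n := fun q => omegaCenter q.1.1 (rep q.1.2.1)
  let F : BallIndex p n rep → ℕ × ((Fin n → ℕ) × (Fin n → Fin p)) := fun q =>
    ((-q.1.1).toNat, (fun i => d (-q.1.1).toNat (c q i), q.1.2.2))
  let S : ℕ → Finset ((Fin n → ℕ) × (Fin n → Fin p)) := fun N =>
    Fintype.piFinset (fun _ => Finset.range (p ^ N)) ×ˢ Finset.univ
  let v : ℕ × ((Fin n → ℕ) × (Fin n → Fin p)) → ℝ := fun z =>
    if z.2 ∈ S z.1 then w (-z.1) else 0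
  have hF : Function.Injective F := by
    intro q q' h
    simp only [F, Prod.mk.injEq] at h
    obtain ⟨h1, h2, h3⟩ := h
    have hγ : q.1.1 = q'.1.1 := by have := q.mem_and_le.1; have := q'.mem_and_le.1; lia
    have hN : (-(((-q.1.1).toNat : ℕ) : ℤ)) = q.1.1 := by have := q.mem_and_le.1; lia
    have hnear : ∀ q : BallIndex p n rep, ∀ i,
        ‖c q i - (d (-q.1.1).toNat (c q i) : ℕ)‖ ≤ (p : ℝ) ^ (-(((-q.1.1).toNat : ℕ) : ℤ)) :=
      fun q i => hd _ _ ((norm_le_pi_norm (c q) i).trans q.mem_and_le.2)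
    have hcc : c q - c q' ∈ zball p n q.1.1 := by
      rw [mem_zball, pi_norm_le_iff_of_nonneg (zpow_pos prime_pos_real _).le]
      intro i
      have e1 := hnear q i
      have e2 := hnear q' i
      have hdigit : d (-q.1.1).toNat (c q i) = d (-q'.1.1).toNat (c q' i) := congrFun h2 i
      rw [← hdigit, ← h1, ← norm_neg] at e2
      rw [hN] at e1 e2
      have := (IsUltrametricDist.norm_add_le_max _ _).trans (max_le e1 e2)
      simpa using this
    have hb : q.1.2.1 = scaledClass p n q.1.1 (c q) := by
      rw [← sub_omegaCenter_mem_iff hrep]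
      simpa [c] using zero_mem_zball q.1.1
    have hb' : q'.1.2.1 = scaledClass p n q.1.1 (c q) := by
      rw [← sub_omegaCenter_mem_iff hrep]
      simpa only [c, ← hγ] using hcc
    exact Subtype.ext (Prod.ext hγ (Prod.ext (hb.trans hb'.symm) h3))
  have hv : Summable v := by
    rw [summable_prod_of_nonneg fun z => by simp only [v]; split_ifs; exacts [hw _, le_rfl]]
    have hfib : ∀ N, ∀ z ∉ S N, v (N, z) = 0 := fun N z hz => if_neg hz
    refine ⟨fun N => summable_of_ne_finset_zero (hfib N), (hsum.mul_left ((p : ℝ) ^ n)).congr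
      fun N => ?_⟩
    have hval : ∀ z ∈ S N, v (N, z) = w (-N) := fun z hz => if_pos hz
    rw [tsum_eq_sum (hfib N), Finset.sum_congr rfl hval, Finset.sum_const, nsmul_eq_mul]
    simp only [S, Finset.card_product, Fintype.card_piFinset, Finset.card_range,
      Finset.prod_const, Finset.card_univ, Fintype.card_fin, Fintype.card_fun]
    push_cast
    rw [← pow_mul, ← pow_mul, mul_comm n N]
    ring
  refine (hv.comp_injective hF).congr fun q => ?_
  have hq : (F q).2 ∈ S (F q).1 := by
    simp only [S, F, Finset.mem_product, Fintype.mem_piFinset, Finset.mem_range, Finset.mem_univ,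
      and_true]
    exact fun i => hd_lt _ _
  have hN : (-(((-q.1.1).toNat : ℕ) : ℤ)) = q.1.1 := by have := q.mem_and_le.1; lia
  simp only [Function.comp, v, if_pos hq]
  simp only [F, hN]

end Index

/-! ### The expansion of the heat kernel -/

section Expansion

variable {p : ℕ} [Fact p.Prime] {n : ℕ} {rep : (Fin n → QpModZp p) → QpN p n}
  {β : ℝ} {g : ℝ → ℝ}

theorem isLizorkinOnBall_eigenfun (q : BallIndex p n rep) :
    IsLizorkinOnBall p n (eigenfun p n rep q) where
  locallyConstant := isLocallyConstant_omega _ _ _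
  compactSupport := by
    refine HasCompactSupport.of_support_subset_isCompact (isCompact_zball 0) ?_
    rw [zball_zero]
    exact (subset_tsupport _).trans q.2.2
  support_subset := q.2.2
  integral_eq_zero := integral_omega q.2.1 _

variable (rep g) in
/-- The term `e ^ (-λ t) ω(x) conj (ω(y))` of the heat kernel expansion. -/
noncomputable def heatTerm (x y : QpN p n) (t : ℝ) (q : BallIndex p n rep) : ℂ :=
  (Real.exp (-(eigenval p n rep g q * t)) : ℂ) * eigenfun p n rep q x *
    (starRingEnd ℂ) (eigenfun p n rep q y)

variable (rep g) in
/-- A bound for `heatTerm` that is uniform in `x`, `y` and `t ≥ ε`. -/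
noncomputable def heatBound (ε : ℝ) (q : BallIndex p n rep) : ℝ :=
  Real.exp (-(eigenval p n rep g q * ε)) * ((p : ℝ) ^ n) ^ (-q.1.1)

theorem norm_heatTerm_le (hn : 0 < n) (hg : IsSymbol p n β g) {ε t : ℝ} (ht : ε ≤ t)
    (x y : QpN p n) (q : BallIndex p n rep) : ‖heatTerm rep g x y t q‖ ≤ heatBound rep g ε q := by
  rw [heatTerm, heatBound, norm_mul, norm_mul, RCLike.norm_conj, Complex.norm_real,
    Real.norm_of_nonneg (Real.exp_pos _).le, ← omegaCoeff_mul_self, mul_assoc]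
  have h0 : 0 ≤ eigenval p n rep g q := hg.nonneg hn _
  gcongr
  · exact (omegaCoeff_pos _).le
  · exact norm_omega_le _ _ _ _
  · exact norm_omega_le _ _ _ _

theorem summable_heatBound (hn : 0 < n) (hrep : IsRepresentatives p n rep)
    (hg : IsSymbol p n β g) {ε : ℝ} (hε : 0 < ε) : Summable (heatBound rep g ε) := by
  have hp := prime_pos_real (p := p)
  refine summable_ballIndex hrep
    (w := fun γ => Real.exp (-(g ((p : ℝ) ^ (1 - γ)) * ε)) * ((p : ℝ) ^ n) ^ (-γ))
    (fun γ => by positivity) ?_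
  refine (hg.summable_pow_mul_exp hn (A := (p : ℝ) ^ n * (p : ℝ) ^ n) (by positivity) hε).congr
    fun N => ?_
  rw [neg_neg, zpow_natCast, sub_neg_eq_add, add_comm 1 (N : ℤ), mul_pow]
  ring

/-- For a point `x` of the unit ball, the indices of the eigenfunctions that do not vanish at `x`:
`γ = -N` and `k` are free, `b` is the class of `p ^ (-N) x`. -/
noncomputable def indexAt (hrep : IsRepresentatives p n rep) {x : QpN p n}
    (hx : x ∈ unitBall p n) (z : ℕ × {k : Fin n → Fin p // ∃ i, (k i : ℕ) ≠ 0}) :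
    BallIndex p n rep :=
  ⟨(-(z.1 : ℤ), scaledClass p n (-(z.1 : ℤ)) x, z.2.1), z.2.2, by
    have hc := (sub_omegaCenter_mem_iff hrep).2 (rfl : scaledClass p n (-(z.1 : ℤ)) x = _)
    obtain ⟨i, -⟩ := z.2.2
    rw [tsupport_omega, ball_subset_unitBall_iff i.pos]
    refine ⟨by lia, ?_⟩
    rw [← zball_zero] at hx ⊢
    have := sub_mem_zball hx (zball_mono (by lia : -(z.1 : ℤ) ≤ 0) hc)
    rwa [sub_sub_cancel] at this⟩

theorem indexAt_injective (hrep : IsRepresentatives p n rep) {x : QpN p n}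
    (hx : x ∈ unitBall p n) : Function.Injective (indexAt hrep hx) := by
  intro z z' h
  have h' := congrArg Subtype.val h
  simp only [indexAt, Prod.mk.injEq] at h'
  exact Prod.ext (by have := h'.1; lia) (Subtype.ext h'.2.2)

theorem eigenfun_eq_zero_of_notMem_range (hrep : IsRepresentatives p n rep) {x : QpN p n}
    (hx : x ∈ unitBall p n) {q : BallIndex p n rep} (hq : q ∉ Set.range (indexAt hrep hx)) :
    eigenfun p n rep q x = 0 := by
  refine omega_of_notMem _ fun h => hq ?_
  rw [sub_omegaCenter_mem_iff hrep] at h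
  have hγ : -(((-q.1.1).toNat : ℕ) : ℤ) = q.1.1 := by have := q.mem_and_le.1; lia
  refine ⟨((-q.1.1).toNat, ⟨q.1.2.2, q.2.1⟩), Subtype.ext (Prod.ext hγ (Prod.ext ?_ rfl))⟩
  simp only [indexAt, hγ]
  exact h.symm

open Classical in
theorem heatTerm_indexAt (hrep : IsRepresentatives p n rep) {x : QpN p n}
    (hx : x ∈ unitBall p n) (y : QpN p n) (t : ℝ)
    (z : ℕ × {k : Fin n → Fin p // ∃ i, (k i : ℕ) ≠ 0}) :
    heatTerm rep g x y t (indexAt hrep hx z) =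
      (Real.exp (-(g ((p : ℝ) ^ ((z.1 : ℤ) + 1)) * t)) : ℂ) *
        if x - y ∈ zball p n (-z.1) then
          ((p : ℂ) ^ n) ^ z.1 * chi p (omegaFreq (-z.1) z.2.1 ⬝ᵥ (x - y)) else 0 := by
  set γ : ℤ := -z.1 with hγ
  set x₀ := omegaCenter γ (rep (scaledClass p n γ x)) with hx₀
  have hc : x - x₀ ∈ zball p n γ := (sub_omegaCenter_mem_iff hrep).2 rfl
  have hω : ∀ u, eigenfun p n rep (indexAt hrep hx z) u
      = omega p n γ (rep (scaledClass p n γ x)) z.2.1 u := fun _ => rfl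
  have hev : eigenval p n rep g (indexAt hrep hx z) = g ((p : ℝ) ^ ((z.1 : ℤ) + 1)) := by
    change g ((p : ℝ) ^ (1 - (-(z.1 : ℤ)))) = _
    rw [sub_neg_eq_add, add_comm]
  rw [heatTerm, hev, hω, hω, omega_of_mem _ hc, mul_assoc]
  congr 1
  have hy : y - x₀ ∈ zball p n γ ↔ x - y ∈ zball p n γ := by
    rw [← sub_sub_sub_cancel_right x y x₀]
    exact ⟨fun h => sub_mem_zball hc h, fun h => by simpa using sub_mem_zball hc h⟩
  by_cases h : x - y ∈ zball p n γ
  · have hcoeff : (omegaCoeff p n γ : ℂ) * omegaCoeff p n γ = ((p : ℂ) ^ n) ^ z.1 := by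
      rw [← Complex.ofReal_mul, omegaCoeff_mul_self, hγ, neg_neg, zpow_natCast]
      push_cast
      rfl
    rw [if_pos h, omega_of_mem _ (hy.2 h), map_mul, Complex.conj_ofReal, conj_chi, mul_mul_mul_comm,
      hcoeff, ← chi_add, ← sub_eq_add_neg, ← dotProduct_sub, sub_sub_sub_cancel_right]
  · rw [if_neg h, omega_of_notMem _ (mt hy.1 h), map_zero, mul_zero]

theorem sum_chi_omegaFreq_ne_zero {γ : ℤ} {w : QpN p n} (hw : w ∈ zball p n γ) :
    ∑ k : {k : Fin n → Fin p // ∃ i, (k i : ℕ) ≠ 0}, chi p (omegaFreq γ k.1 ⬝ᵥ w)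
      = (zball p n (γ - 1)).indicator (fun _ => (p : ℂ) ^ n) w - 1 := by
  classical
  rw [← Finset.sum_subtype (Finset.univ.erase (zeroDigits p n))
      (fun k => by rw [← ne_zeroDigits_iff]; simp) fun k => chi p (omegaFreq γ k ⬝ᵥ w),
    Finset.sum_erase_eq_sub (Finset.mem_univ _), sum_chi_omegaFreq hw, omegaFreq_zeroDigits,
    zero_dotProduct, chi_zero]

/-- The terms with `γ = -N` add up to the contribution of the sphere of radius `p ^ (N + 1)` to the
heat kernel. -/
theorem tsum_heatTerm (hn : 0 < n) (hrep : IsRepresentatives p n rep) (hg : IsSymbol p n β g)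
    {x : QpN p n} (hx : x ∈ unitBall p n) (y : QpN p n) {t : ℝ} (ht : 0 < t) :
    ∑' q, heatTerm rep g x y t q = heatKernel p n g (x - y) t := by
  classical
  have hs : Summable (heatTerm rep g x y t) :=
    (summable_heatBound hn hrep hg ht).of_norm_bounded fun q => norm_heatTerm_le hn hg le_rfl x y q
  have hs' : HasSum (fun z => heatTerm rep g x y t (indexAt hrep hx z))
      (∑' q, heatTerm rep g x y t q) := by
    refine ((indexAt_injective hrep hx).hasSum_iff fun q hq => ?_).2 hs.hasSum
    rw [heatTerm, eigenfun_eq_zero_of_notMem_range hrep hx hq, mul_zero, zero_mul]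
  refine (hs'.prod_fiberwise (g := _) fun N => hasSum_fintype _).unique
    ((hasSum_heatKernel hn hg (x - y) ht).congr_fun fun N => ?_)
  simp only [heatTerm_indexAt, ← Finset.mul_sum]
  congr 1
  by_cases h : x - y ∈ zball p n (-N)
  · simp only [if_pos h]
    rw [← Finset.mul_sum, sum_chi_omegaFreq_ne_zero h, Set.indicator_apply, neg_add',
      mul_sub, mul_one, mul_ite, mul_zero, pow_succ]
  · rw [if_neg h, if_neg fun h' => h (zball_mono (by lia) h')]
    simp only [if_neg h, Finset.sum_const_zero, sub_zero]

end Expansion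

end PadicHeat

/-- The sequence `e` lists all eigenfunctions supported in the unit ball, each once; its `m`-th
term, `m = 0, 1, 2, …`, is the eigenfunction that is usually numbered `m + 1`. -/
theorem proposition3 (p : ℕ) [Fact p.Prime] (n : ℕ) (hn : 1 ≤ n) (β : ℝ) (g : ℝ → ℝ)
    (hg : PadicHeat.IsSymbol p n β g)
    (rep : (Fin n → PadicHeat.QpModZp p) → PadicHeat.QpN p n)
    (hrep : PadicHeat.IsRepresentatives p n rep)
    (e : ℕ ≃ PadicHeat.BallIndex p n rep) :
    (∀ m : ℕ, PadicHeat.IsLizorkinOnBall p n (PadicHeat.eigenfun p n rep (e m)) ∧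
      ∀ x : PadicHeat.QpN p n,
        PadicHeat.pseudoDiff p n g (PadicHeat.eigenfun p n rep (e m)) x =
          (PadicHeat.eigenval p n rep g (e m) : ℂ) * PadicHeat.eigenfun p n rep (e m) x) ∧
    (∀ (x : PadicHeat.QpN p n) (t : ℝ), 0 < t →
      IntegrableOn (PadicHeat.heatIntegrand p n g x t) (PadicHeat.unitBall p n)ᶜ
        (PadicHeat.haar p n)) ∧
    ∀ ε : ℝ, 0 < ε →
      TendstoUniformlyOn
        (fun (M : ℕ) (z : PadicHeat.QpN p n × PadicHeat.QpN p n × ℝ) =>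
          ∑ m ∈ Finset.range M,
            (Real.exp (-(PadicHeat.eigenval p n rep g (e m)) * z.2.2) : ℂ) *
              PadicHeat.eigenfun p n rep (e m) z.1 *
              (starRingEnd ℂ) (PadicHeat.eigenfun p n rep (e m) z.2.1))
        (fun z => PadicHeat.heatKernel p n g (z.1 - z.2.1) z.2.2)
        atTop
        (PadicHeat.unitBall p n ×ˢ PadicHeat.unitBall p n ×ˢ Set.Ici ε) := by
  refine ⟨fun m => ⟨?_, fun x => ?_⟩, fun x t ht => ?_, fun ε hε => ?_⟩
  · exact PadicHeat.isLizorkinOnBall_eigenfun (e m)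
  · exact PadicHeat.pseudoDiff_omega g _ _ (e m).2.1 x
  · exact PadicHeat.integrableOn_heatIntegrand hn hg x ht
  have hu : Summable fun m => PadicHeat.heatBound rep g ε (e m) :=
    (PadicHeat.summable_heatBound hn hrep hg hε).comp_injective e.injective
  have h := tendstoUniformlyOn_tsum_nat hu
    (f := fun m (z : PadicHeat.QpN p n × PadicHeat.QpN p n × ℝ) =>
      PadicHeat.heatTerm rep g z.1 z.2.1 z.2.2 (e m))
    (s := PadicHeat.unitBall p n ×ˢ PadicHeat.unitBall p n ×ˢ Set.Ici ε)
    fun m z hz => PadicHeat.norm_heatTerm_le hn hg hz.2.2 _ _ _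
  simp only [PadicHeat.heatTerm, ← neg_mul] at h
  refine h.congr_right fun z hz => ?_
  rw [← PadicHeat.tsum_heatTerm hn hrep hg hz.1 z.2.1 (hε.trans_le hz.2.2), ← e.tsum_eq]
  simp only [PadicHeat.heatTerm, neg_mul]
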